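/- Let $F$ be a (real) Banach lattice and let $H$ be a closed linear subspace of $F$. A sequence $(f_n)_{n\in\mathbb N}$ in $F$ is called disjoint if $|f_m|\wedge|f_n|=0$ whenever $m\neq n$. A linear subspace $E$ of $F$ is called dispersed if there are no sequence $(e_n)$ of norm-one elements of $E$ and disjoint sequence $(f_n)$ in $F$ such that $\|f_n-e_n\|\to 0$; it is called anti-dispersed if it contains no infinite-dimensional dispersed linear subspace. A bounded operator between Banach spaces is strictly singular if it is not bounded from below on any infinite-dimensional subspace of its domain. A bounded operator $T$ from $F$ into a Banach space is called disjointly non-singular (DNS) if, for every disjoint sequence $(f_n)$ of nonzero elements of $F$, the restriction of $T$ to $\overline{\mathrm{span}}\{f_n\}_{n\in\mathbb N}$ is not strictly singular. Then the following conditions are equivalent: (i) $H$ is dispersed; (ii) the quotient map $Q_H\colon F\to F/H$ is DNS; (iii) for every closed anti-dispersed subspace $G$ of $F$, the space $G\cap H$ is finite-dimensional and $G+H$ is closed in $F$; (iv) for every disjoint sequence $(f_n)_{n\in\mathbb N}$ in $F$, the space $\overline{\mathrm{span}}\{f_n\}_{n\in\mathbb N}\cap H$ is finite-dimensional and $\overline{\mathrm{span}}\{f_n\}_{n\in\mathbb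 N}+H$ is closed in $F$. -/

import Mathlib

open Filter Topology

namespace BanachLattice

/-- The elements of the sequence are pairwise disjoint: `|f m| ∧ |f n| = 0` for `m ≠ n`
(zero terms are allowed). -/
def IsDisjointSeq {F : Type*} [Lattice F] [AddCommGroup F] (f : ℕ → F) : Prop :=
  Pairwise fun m n => |f m| ⊓ |f n| = 0

/-- The closed linear span of a sequence. -/
def closedSpan {F : Type*} [NormedAddCommGroup F] [NormedSpace ℝ F] (f : ℕ → F) :
    Submodule ℝ F :=
  (Submodule.span ℝ (Set.range f)).topologicalClosure

/-- A sequence is almost disjoint if it is at distance tending to zero from some disjoint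
sequence. -/
def IsAlmostDisjointSeq {F : Type*} [NormedAddCommGroup F] [Lattice F] (e : ℕ → F) : Prop :=
  ∃ f : ℕ → F, IsDisjointSeq f ∧ Tendsto (fun n => ‖f n - e n‖) atTop (𝓝 0)

/-- A subspace is dispersed if its unit sphere contains no almost disjoint sequence. -/
def IsDispersed {F : Type*} [NormedAddCommGroup F] [NormedSpace ℝ F] [Lattice F]
    (H : Submodule ℝ F) : Prop :=
  ¬ ∃ e : ℕ → F, (∀ n, e n ∈ H ∧ ‖e n‖ = 1) ∧ IsAlmostDisjointSeq e

/-- A subspace is anti-dispersed if it contains no infinite-dimensional dispersed subspace. -/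
def IsAntiDispersed {F : Type*} [NormedAddCommGroup F] [NormedSpace ℝ F] [Lattice F]
    (G : Submodule ℝ F) : Prop :=
  ¬ ∃ K : Submodule ℝ F, K ≤ G ∧ ¬ FiniteDimensional ℝ K ∧ IsDispersed K

/-- An operator is strictly singular if it is not bounded from below on any
infinite-dimensional subspace. -/
def IsStrictlySingular {X Y : Type*} [NormedAddCommGroup X] [NormedSpace ℝ X]
    [NormedAddCommGroup Y] [NormedSpace ℝ Y] (T : X →L[ℝ] Y) : Prop :=
  ¬ ∃ M : Submodule ℝ X, ¬ FiniteDimensional ℝ M ∧ ∃ c : ℝ, 0 < c ∧ ∀ x ∈ M, c * ‖x‖ ≤ ‖T x‖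

/-- An operator on a Banach lattice is disjointly non-singular (DNS) if its restriction to the
closed span of a disjoint sequence of nonzero vectors is never strictly singular. -/
def IsDNS {F E : Type*} [NormedAddCommGroup F] [NormedSpace ℝ F] [Lattice F]
    [NormedAddCommGroup E] [NormedSpace ℝ E] (T : F →L[ℝ] E) : Prop :=
  ∀ f : ℕ → F, IsDisjointSeq f → (∀ n, f n ≠ 0) →
    ¬ IsStrictlySingular (T.comp (closedSpan f).subtypeL)

end BanachLattice

/-! The cycle is (i) → (iii) → (iv) → (ii) → (i), with `Q` the quotient map by `H`. (i) → (iii): if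
the conclusion fails for `G`, then `Q` has infinite-dimensional kernel or non-closed range on `G`,
so it is compact on some infinite-dimensional `K ≤ G`
(`exists_infinite_dimensional_compact_restriction`). An almost disjoint unit sequence in `K` would
have differences almost in `H`, still almost disjoint and bounded away from zero; so `K` is
dispersed (`IsDispersed.of_compact_mkQL`). (iii) → (iv): closed spans of disjoint sequences are
anti-dispersed, by a gliding hump. (iv) → (ii): finite-dimensional kernel and closed range make `Q`
bounded below on a complement of the kernel. (ii) → (i): a disjoint sequence close to unit vectors
of `H` has a subsequence on which `Q` decays geometrically, hence `Q` is strictly singular on its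
closed span. -/

namespace BanachLattice

/-! ### Disjointness in vector lattices -/

section Lattice

lemma IsDisjointSeq.comp {F : Type*} [AddCommGroup F] [Lattice F] {f : ℕ → F} (hf : IsDisjointSeq f) {φ : ℕ → ℕ}
    (hφ : Function.Injective φ) : IsDisjointSeq (f ∘ φ) :=
  fun _ _ h => hf (hφ.ne h)


variable {F : Type*} [AddCommGroup F] [Lattice F] [IsOrderedAddMonoid F]

lemma abs_add_inf_abs_eq_zero {x y z : F} (hx : |x| ⊓ |z| = 0) (hy : |y| ⊓ |z| = 0) :
    |x + y| ⊓ |z| = 0 := by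
  refine le_antisymm ?_ (le_inf (abs_nonneg _) (abs_nonneg _))
  set w := |x + y| ⊓ |z| with hw
  have h1 : w - |y| ≤ |x| ⊓ |z| := by
    refine le_inf ?_ ?_
    · rw [sub_le_iff_le_add]; exact inf_le_left.trans (abs_add_le x y)
    · rw [sub_le_iff_le_add]; exact inf_le_right.trans (le_add_of_nonneg_right (abs_nonneg _))
  rw [hx, sub_nonpos] at h1
  rw [← hy]
  exact le_inf h1 inf_le_right

lemma abs_le_abs_add_of_inf_eq_zero {x y : F} (h : |x| ⊓ |y| = 0) : |x| ≤ |x + y| := by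
  have h1 : |x| - |x + y| ≤ |x| ⊓ |y| := by
    refine le_inf (sub_le_self _ (abs_nonneg _)) ?_
    rw [sub_le_iff_le_add]
    calc |x| = |-y + (x + y)| := by congr 1; abel
      _ ≤ |y| + |x + y| := by simpa using abs_add_le (-y) (x + y)
  rwa [h, sub_nonpos] at h1

omit [IsOrderedAddMonoid F] in
lemma abs_smul_le [Module ℝ F] [IsOrderedModule ℝ F] (c : ℝ) (x : F) : |c • x| ≤ |c| • |x| := by
  have key (y : F) (hy : |y| = |x|) (d : ℝ) (hd : 0 ≤ d) : |d • y| ≤ d • |x| := by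
    rw [← hy]
    refine abs_le'.2 ⟨smul_le_smul_of_nonneg_left (le_abs_self y) hd, ?_⟩
    rw [← smul_neg]
    exact smul_le_smul_of_nonneg_left (neg_le_abs y) hd
  rcases le_total 0 c with h | h
  · rw [abs_of_nonneg h]; exact key x rfl c h
  · rw [abs_of_nonpos h, ← abs_neg, ← neg_smul]; exact key x rfl _ (neg_nonneg.2 h)

/-- The disjoint complement of a vector. -/
def disjointCompl [Module ℝ F] [IsOrderedModule ℝ F] (z : F) : Submodule ℝ F where
  carrier := {x | |x| ⊓ |z| = 0}
  zero_mem' := by simp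
  add_mem' := abs_add_inf_abs_eq_zero
  smul_mem' c x hx := by
    -- A real multiple is dominated by an integer multiple, which closure under addition handles.
    obtain ⟨n, hcn⟩ := exists_nat_ge |c|
    have hb (n : ℕ) : |(n • |x|)| ⊓ |z| = 0 := by
      induction n with
      | zero => simp
      | succ n ih =>
        rw [succ_nsmul]
        exact abs_add_inf_abs_eq_zero ih (by rw [abs_abs]; exact hx)
    refine le_antisymm ?_ (le_inf (abs_nonneg _) (abs_nonneg _))
    rw [← hb n]
    refine inf_le_inf_right _ ((abs_smul_le c x).trans (le_trans ?_ (le_abs_self _)))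
    rw [← Nat.cast_smul_eq_nsmul ℝ]
    exact smul_le_smul_of_nonneg_right hcn (abs_nonneg _)

variable [Module ℝ F] [IsOrderedModule ℝ F]

lemma mem_disjointCompl {x z : F} : x ∈ disjointCompl z ↔ |x| ⊓ |z| = 0 := Iff.rfl

lemma mem_disjointCompl_comm {x z : F} : x ∈ disjointCompl z ↔ z ∈ disjointCompl x := by
  rw [mem_disjointCompl, mem_disjointCompl, inf_comm]

/-- Spans of disjoint parts of a disjoint sequence are disjoint. -/
lemma IsDisjointSeq.inf_eq_zero_of_mem_span {f : ℕ → F} (hf : IsDisjointSeq f) {s t : Set ℕ}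
    (hst : Disjoint s t) {x y : F} (hx : x ∈ Submodule.span ℝ (f '' s))
    (hy : y ∈ Submodule.span ℝ (f '' t)) : |x| ⊓ |y| = 0 := by
  have h1 : ∀ n ∈ t, x ∈ disjointCompl (f n) := by
    intro n hn
    refine (Submodule.span_le.2 ?_) hx
    rintro _ ⟨m, hm, rfl⟩
    exact hf (fun h => Set.disjoint_left.1 hst hm (h ▸ hn))
  refine mem_disjointCompl.1 (mem_disjointCompl_comm.1 ?_)
  refine (Submodule.span_le.2 ?_) hy
  rintro _ ⟨n, hn, rfl⟩
  exact mem_disjointCompl_comm.1 (h1 n hn)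

end Lattice

/-! ### Disjoint sequences and the norm -/

section Norm

variable {F : Type*} [NormedAddCommGroup F] [NormedSpace ℝ F] [Lattice F]
    [IsOrderedAddMonoid F] [IsOrderedModule ℝ F] [HasSolidNorm F]

/-- One term is disjoint from the sum of the others, so the norm's solidity applies. -/
lemma IsDisjointSeq.norm_smul_le_norm_linearCombination {f : ℕ → F} (hf : IsDisjointSeq f)
    (a : ℕ →₀ ℝ) (k : ℕ) : ‖a k • f k‖ ≤ ‖Finsupp.linearCombination ℝ f a‖ := by
  have hsplit : Finsupp.linearCombination ℝ f a
      = a k • f k + Finsupp.linearCombination ℝ f (a.erase k) := by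
    conv_lhs => rw [← Finsupp.single_add_erase k a]
    simp
  rw [hsplit]
  refine norm_le_norm_of_abs_le_abs (abs_le_abs_add_of_inf_eq_zero ?_)
  refine hf.inf_eq_zero_of_mem_span (s := {k}) (t := {k}ᶜ) disjoint_compl_right
    (Submodule.smul_mem _ _ (Submodule.subset_span ⟨k, rfl, rfl⟩)) ?_
  rw [Finsupp.mem_span_image_iff_linearCombination]
  refine ⟨a.erase k, ?_, rfl⟩
  rw [Finsupp.mem_supported]
  intro j hj
  rintro rfl
  simp at hj

lemma IsDisjointSeq.linearIndependent {f : ℕ → F} (hf : IsDisjointSeq f) (h0 : ∀ n, f n ≠ 0) :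
    LinearIndependent ℝ f := by
  rw [linearIndependent_iff]
  intro a ha
  ext k
  have := hf.norm_smul_le_norm_linearCombination a k
  rw [ha, norm_zero, norm_le_zero_iff, smul_eq_zero] at this
  simpa [h0 k] using this

omit [HasSolidNorm F] in
/-- A subspace is not dispersed as soon as it contains an almost disjoint sequence that is bounded
away from zero. -/
lemma not_isDispersed_of_tendsto {H : Submodule ℝ F} {h d : ℕ → F} (hH : ∀ n, h n ∈ H)
    (hd : IsDisjointSeq d) {c : ℝ} (hc : 0 < c) (hh : ∀ᶠ n in atTop, c ≤ ‖h n‖)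
    (hlim : Tendsto (fun n => ‖d n - h n‖) atTop (𝓝 0)) : ¬ IsDispersed H := by
  obtain ⟨N, hN⟩ := eventually_atTop.1 hh
  have hpos (n : ℕ) : c ≤ ‖h (n + N)‖ := hN _ (by omega)
  refine not_not.2 ⟨fun n => ‖h (n + N)‖⁻¹ • h (n + N), fun n => ⟨H.smul_mem _ (hH _), ?_⟩,
    fun n => ‖h (n + N)‖⁻¹ • d (n + N), ?_, ?_⟩
  · rw [norm_smul, norm_inv, norm_norm]
    exact inv_mul_cancel₀ (hc.trans_le (hpos n)).ne'
  · intro m n hmn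
    refine (disjointCompl _).smul_mem _ (mem_disjointCompl_comm.1 ?_)
    exact (disjointCompl _).smul_mem _ (hd (by simpa using hmn.symm))
  · have hlim' : Tendsto (fun n => c⁻¹ * ‖d (n + N) - h (n + N)‖) atTop (𝓝 0) := by
      simpa using ((tendsto_add_atTop_iff_nat N).2 hlim).const_mul c⁻¹
    refine squeeze_zero (fun _ => norm_nonneg _) (fun n => ?_) hlim'
    rw [← smul_sub, norm_smul, norm_inv, norm_norm]
    gcongr
    exact hpos n

end Norm

/-! ### Infinite-dimensional subspaces meet tails -/

section Tail

variable {F : Type*} [NormedAddCommGroup F] [NormedSpace ℝ F]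

/-- Otherwise `K` would embed into the image of `W` in `F ⧸ L`. -/
lemma exists_ne_zero_mem_inf_of_le_sup {K L W : Submodule ℝ F} (hK : ¬ FiniteDimensional ℝ K)
    [FiniteDimensional ℝ W] (h : K ≤ L ⊔ W) : ∃ x ∈ K ⊓ L, x ≠ 0 := by
  by_contra! hne
  apply hK
  let g : K →ₗ[ℝ] (W.map L.mkQ) := (L.mkQ.comp K.subtype).codRestrict _ (by
    rintro ⟨x, hx⟩
    obtain ⟨l, hl, w, hw, rfl⟩ := Submodule.mem_sup.1 (h hx)
    refine ⟨w, hw, ?_⟩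
    simpa using hl)
  refine FiniteDimensional.of_injective g ((injective_iff_map_eq_zero g).2 ?_)
  rintro ⟨x, hx⟩ hgx
  have : L.mkQ x = 0 := congrArg Subtype.val hgx
  rw [Submodule.mkQ_apply, Submodule.Quotient.mk_eq_zero] at this
  exact Subtype.ext (hne x ⟨hx, this⟩)

lemma exists_norm_eq_one_of_ne_zero {K : Submodule ℝ F} (h : ∃ x ∈ K, x ≠ 0) :
    ∃ x ∈ K, ‖x‖ = 1 := by
  obtain ⟨x, hx, h0⟩ := h
  refine ⟨‖x‖⁻¹ • x, K.smul_mem _ hx, ?_⟩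
  rw [norm_smul, norm_inv, norm_norm, inv_mul_cancel₀ (norm_ne_zero_iff.2 h0)]

lemma closedSpan_le_tail_sup (f : ℕ → F) (n : ℕ) :
    closedSpan f ≤ (Submodule.span ℝ (f '' Set.Ici n)).topologicalClosure ⊔
      Submodule.span ℝ (f '' Set.Iio n) := by
  have : FiniteDimensional ℝ (Submodule.span ℝ (f '' Set.Iio n)) :=
    FiniteDimensional.span_of_finite ℝ ((Set.finite_Iio n).image f)
  refine Submodule.topologicalClosure_minimal _ ?_ ?_
  · rw [← Set.image_univ, ← Set.Ici_union_Iio (a := n), Set.image_union, Submodule.span_union]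
    exact sup_le_sup_right (Submodule.le_topologicalClosure _) _
  · exact Submodule.isClosed_sup_finiteDimensional _ _ (Submodule.isClosed_topologicalClosure _)

/-- An infinite-dimensional subspace of the closed span of a sequence contains unit vectors that
are arbitrarily close to vectors in a tail of that sequence. -/
lemma exists_norm_eq_one_mem_tail {f : ℕ → F} {K : Submodule ℝ F} (hK : ¬ FiniteDimensional ℝ K)
    (hKf : K ≤ closedSpan f) (n : ℕ) :
    ∃ x ∈ K, ‖x‖ = 1 ∧ x ∈ (Submodule.span ℝ (f '' Set.Ici n)).topologicalClosure := by
  have : FiniteDimensional ℝ (Submodule.span ℝ (f '' Set.Iio n)) :=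
    FiniteDimensional.span_of_finite ℝ ((Set.finite_Iio n).image f)
  obtain ⟨x, hx, h1⟩ := exists_norm_eq_one_of_ne_zero
    (exists_ne_zero_mem_inf_of_le_sup hK (hKf.trans (closedSpan_le_tail_sup f n)))
  exact ⟨x, hx.1, h1, hx.2⟩

end Tail

/-! ### Finite-dimensional kernel and closed range -/

section Operator

variable {F Y : Type*} [NormedAddCommGroup F] [NormedSpace ℝ F]
  [NormedAddCommGroup Y] [NormedSpace ℝ Y]

omit [NormedSpace ℝ F] in
lemma not_finiteDimensional_span [Module ℝ F] {x : ℕ → F} (hx : LinearIndependent ℝ x) :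
    ¬ FiniteDimensional ℝ (Submodule.span ℝ (Set.range x)) := fun _ =>
  Infinite.not_finite (Module.Finite.finite_basis (Module.Basis.span hx))

/-- An operator that is bounded below on a closed finite-codimensional subspace of `G` has
finite-dimensional kernel and closed range on `G`. -/
lemma finiteDimensional_inf_ker_and_isClosed_map [CompleteSpace F] {T : F →L[ℝ] Y}
    {G : Submodule ℝ F}
    (hG : IsClosed (G : Set F)) {V : Type*} [NormedAddCommGroup V] [NormedSpace ℝ V]
    [FiniteDimensional ℝ V] (φ : F →L[ℝ] V) {c : ℝ} (hc : 0 < c)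
    (hb : ∀ x ∈ G, φ x = 0 → c * ‖x‖ ≤ ‖T x‖) :
    FiniteDimensional ℝ (G ⊓ LinearMap.ker T.toLinearMap : Submodule ℝ F) ∧
      IsClosed ((G.map T.toLinearMap : Submodule ℝ Y) : Set Y) := by
  constructor
  · refine FiniteDimensional.of_injective (φ.toLinearMap.comp (Submodule.subtype _))
      ((injective_iff_map_eq_zero _).2 ?_)
    rintro ⟨x, hxG, hxT⟩ hx
    have h1 := hb x hxG hx
    have h2 : T x = 0 := hxT
    rw [h2, norm_zero] at h1
    exact Subtype.ext (norm_le_zero_iff.1 (by nlinarith [norm_nonneg x]))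
  · set G₀ : Submodule ℝ F := G ⊓ LinearMap.ker φ.toLinearMap with hG₀
    have hcl : IsClosed (G₀ : Set F) := hG.inter φ.isClosed_ker
    have : CompleteSpace G₀ := hcl.completeSpace_coe
    have hclT : IsClosed ((G₀.map T.toLinearMap : Submodule ℝ Y) : Set Y) := by
      have hanti : AntilipschitzWith (Real.toNNReal c⁻¹) (T.comp G₀.subtypeL) := by
        refine AddMonoidHomClass.antilipschitz_of_bound _ fun x => ?_
        have h1 := hb x x.2.1 x.2.2
        rw [Real.coe_toNNReal _ (inv_nonneg.2 hc.le), ← div_eq_inv_mul, le_div_iff₀ hc, mul_comm]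
        exact h1
      have := hanti.isClosed_range (T.comp G₀.subtypeL).uniformContinuous
      convert this using 1
      ext y
      simp
    -- `φ` is injective on `W`, so `W` is finite-dimensional and adding its image keeps the range
    -- closed.
    obtain ⟨W, hW⟩ := Submodule.exists_isCompl (LinearMap.ker (φ.toLinearMap.comp G.subtype))
    have hWfin : FiniteDimensional ℝ W := by
      refine FiniteDimensional.of_injective ((φ.toLinearMap.comp G.subtype).comp W.subtype)
        ((injective_iff_map_eq_zero _).2 ?_)
      rintro ⟨x, hx⟩ h
      have hx0 : x ∈ (⊥ : Submodule ℝ G) := hW.inf_eq_bot ▸ ⟨h, hx⟩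
      exact Subtype.ext ((Submodule.mem_bot ℝ).1 hx0)
    have hsum : G.map T.toLinearMap =
        G₀.map T.toLinearMap ⊔ (W.map G.subtype).map T.toLinearMap := by
      rw [← Submodule.map_sup]
      congr 1
      conv_lhs => rw [← Submodule.map_subtype_top G, ← hW.sup_eq_top, Submodule.map_sup]
      congr 1
      rw [LinearMap.ker_comp, Submodule.map_comap_subtype]
    rw [hsum]
    exact Submodule.isClosed_sup_finiteDimensional _ _ hclT

lemma exists_norm_eq_one_norm_le [CompleteSpace F] {T : F →L[ℝ] Y} {G : Submodule ℝ F}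
    (hG : IsClosed (G : Set F))
    (hT : ¬ (FiniteDimensional ℝ (G ⊓ LinearMap.ker T.toLinearMap : Submodule ℝ F) ∧
      IsClosed ((G.map T.toLinearMap : Submodule ℝ Y) : Set Y)))
    {V : Type*} [NormedAddCommGroup V] [NormedSpace ℝ V]
    [FiniteDimensional ℝ V] (φ : F →L[ℝ] V) {ε : ℝ} (hε : 0 < ε) :
    ∃ x ∈ G, ‖x‖ = 1 ∧ φ x = 0 ∧ ‖T x‖ ≤ ε := by
  by_contra! h
  refine hT (finiteDimensional_inf_ker_and_isClosed_map hG φ hε fun x hx hφ => ?_)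
  rcases eq_or_ne x 0 with rfl | h0
  · simp
  have hpos : 0 < ‖x‖ := norm_pos_iff.2 h0
  have := h (‖x‖⁻¹ • x) (G.smul_mem _ hx)
    (by rw [norm_smul, norm_inv, norm_norm, inv_mul_cancel₀ hpos.ne']) (by rw [map_smul, hφ, smul_zero])
  rw [map_smul, norm_smul, norm_inv, norm_norm, ← div_eq_inv_mul, lt_div_iff₀ hpos] at this
  exact this.le

/-- For a sequence with a triangular system of norming functionals, the coefficients of a linear
combination are controlled by its norm. -/
lemma abs_coeff_le_of_triangular {x : ℕ → F} {φ : ℕ → StrongDual ℝ F} (hφ : ∀ n, ‖φ n‖ ≤ 1)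
    (h1 : ∀ n, φ n (x n) = 1) (hx : ∀ n, ‖x n‖ = 1) (h0 : ∀ m n, m < n → φ m (x n) = 0)
    (a : ℕ →₀ ℝ) (k : ℕ) : |a k| ≤ 2 ^ k * ‖Finsupp.linearCombination ℝ x a‖ := by
  induction k using Nat.strong_induction_on with
  | _ k ih =>
    set v := Finsupp.linearCombination ℝ x a with hv
    -- Triangularity removes the terms beyond `k`; the bound then follows from `1 + ∑ j < k, 2 ^ j =
    -- 2 ^ k`.
    have hφv : φ k v = a k + ∑ j ∈ Finset.range k, a j * φ k (x j) := by
      obtain ⟨N, hN⟩ : ∃ N, a.support ⊆ Finset.range N := a.support.exists_nat_subset_range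
      have hN' : a.support ⊆ Finset.range (k + 1 + N) :=
        hN.trans (Finset.range_subset_range.2 (by omega))
      rw [hv, Finsupp.linearCombination_apply, Finsupp.sum_of_support_subset a hN' _ (by simp),
        map_sum, Finset.sum_range_add, Finset.sum_range_succ, Finset.sum_eq_zero (s := Finset.range N)]
      · simp [h1]; ring
      · intro j _
        rw [map_smul, h0 k _ (by omega), smul_zero]
    have hφle (y : F) : |φ k y| ≤ ‖y‖ := by
      simpa using (φ k).le_of_opNorm_le (hφ k) y
    have hak : a k = φ k v - ∑ j ∈ Finset.range k, a j * φ k (x j) := by rw [hφv]; ring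
    calc |a k| ≤ |φ k v| + |∑ j ∈ Finset.range k, a j * φ k (x j)| := by
          rw [hak]; exact abs_sub _ _
      _ ≤ ‖v‖ + ∑ j ∈ Finset.range k, 2 ^ j * ‖v‖ := by
          refine add_le_add (hφle v) ((Finset.abs_sum_le_sum_abs _ _).trans
            (Finset.sum_le_sum fun j hj => ?_))
          rw [abs_mul]
          have := hφle (x j)
          rw [hx] at this
          exact (mul_le_of_le_one_right (abs_nonneg _) this).trans (ih j (Finset.mem_range.1 hj))
      _ = 2 ^ k * ‖v‖ := by
          rw [← Finset.sum_mul, geom_sum_eq (by norm_num) k]; ring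

/-- If `T` does not have finite-dimensional kernel and closed range on `G`, then `T` is compact
on some infinite-dimensional subspace of `G`. -/
lemma exists_infinite_dimensional_compact_restriction [CompleteSpace F] [CompleteSpace Y]
    {T : F →L[ℝ] Y} {G : Submodule ℝ F} (hG : IsClosed (G : Set F))
    (hT : ¬ (FiniteDimensional ℝ (G ⊓ LinearMap.ker T.toLinearMap : Submodule ℝ F) ∧
      IsClosed ((G.map T.toLinearMap : Submodule ℝ Y) : Set Y))) :
    ∃ K ≤ G, ¬ FiniteDimensional ℝ K ∧ ∀ e : ℕ → F, (∀ n, e n ∈ K ∧ ‖e n‖ ≤ 1) →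
      ∃ y, ∃ ψ : ℕ → ℕ, StrictMono ψ ∧ Tendsto (fun n => T (e (ψ n))) atTop (𝓝 y) := by
  -- Each triple is a unit vector, a norming functional and a decay exponent. The exponents increase
  -- strictly, so the decay `4⁻ⁿ` beats the coefficient growth `2ⁿ`.
  obtain ⟨g, hgP, hgr⟩ := exists_seq_of_forall_finset_exists
    (fun p : F × StrongDual ℝ F × ℕ => p.1 ∈ G ∧ ‖p.1‖ = 1 ∧ ‖p.2.1‖ ≤ 1 ∧ p.2.1 p.1 = 1 ∧
      ‖T p.1‖ ≤ (1 / 4) ^ p.2.2)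
    (fun p q => p.2.1 q.1 = 0 ∧ p.2.2 < q.2.2) (by
      intro s _
      obtain ⟨N, hN⟩ := (s.image fun p => p.2.2).exists_nat_subset_range
      obtain ⟨x, hxG, hx1, hx0, hxT⟩ := exists_norm_eq_one_norm_le hG hT
        (ContinuousLinearMap.pi fun p : s => p.1.2.1) (ε := (1 / 4) ^ N) (by positivity)
      obtain ⟨φ, hφ, hφx⟩ := exists_dual_vector'' ℝ x
      refine ⟨(x, φ, N), ⟨hxG, hx1, hφ, by simpa [hx1] using hφx, hxT⟩, fun p hp => ⟨?_, ?_⟩⟩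
      · exact congrFun hx0 ⟨p, hp⟩
      · exact Finset.mem_range.1 (hN (Finset.mem_image_of_mem _ hp)))
  set x : ℕ → F := fun n => (g n).1
  have hmono : StrictMono fun n => (g n).2.2 := fun m n h => (hgr m n h).2
  have hTx (n : ℕ) : ‖T (x n)‖ ≤ (1 / 4) ^ n :=
    (hgP n).2.2.2.2.trans (pow_le_pow_of_le_one (by norm_num) (by norm_num) hmono.le_apply)
  have hcoef := abs_coeff_le_of_triangular (x := x) (φ := fun n => (g n).2.1)
    (fun n => (hgP n).2.2.1) (fun n => (hgP n).2.2.2.1) (fun n => (hgP n).2.1)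
    (fun m n h => (hgr m n h).1)
  refine ⟨Submodule.span ℝ (Set.range x), Submodule.span_le.2 ?_, ?_, ?_⟩
  · rintro _ ⟨n, rfl⟩
    exact (hgP n).1
  · have hli : LinearIndependent ℝ x := by
      rw [linearIndependent_iff]
      intro a ha
      ext k
      have := hcoef a k
      rw [ha, norm_zero, mul_zero] at this
      simpa using this
    exact not_finiteDimensional_span hli
  · intro e he
    -- The image under `T` of the unit ball of `K` lies in a continuous image of this
    -- Tychonoff-compact box.
    set C : Set (ℕ → ℝ) := Set.pi Set.univ fun k => Set.Icc (-2 ^ k) (2 ^ k)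
    have hC : IsCompact C := isCompact_univ_pi fun _ => isCompact_Icc
    have hcont : ContinuousOn (fun a : ℕ → ℝ => ∑' k, a k • T (x k)) C := by
      refine continuousOn_tsum (u := fun k => (1 / 2 : ℝ) ^ k) (fun k => by fun_prop)
        (summable_geometric_of_lt_one (by norm_num) (by norm_num)) fun k a ha => ?_
      have hak := ha k (Set.mem_univ k)
      rw [norm_smul, Real.norm_eq_abs]
      calc |a k| * ‖T (x k)‖ ≤ 2 ^ k * (1 / 4) ^ k := by
            gcongr
            · exact abs_le.2 ⟨hak.1, hak.2⟩
            · exact hTx k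
        _ = (1 / 2) ^ k := by rw [← mul_pow]; norm_num
    have hmem (n : ℕ) : T (e n) ∈ (fun a : ℕ → ℝ => ∑' k, a k • T (x k)) '' C := by
      obtain ⟨a, ha⟩ := Finsupp.mem_span_range_iff_exists_finsupp.1 (he n).1
      have ha' : Finsupp.linearCombination ℝ x a = e n := ha
      refine ⟨a, fun k _ => ?_, ?_⟩
      · have := hcoef a k
        rw [ha'] at this
        exact abs_le.1 (this.trans (mul_le_of_le_one_right (by positivity) (he n).2))
      · rw [← ha', Finsupp.linearCombination_apply, Finsupp.sum, map_sum]
        refine (tsum_eq_sum (s := a.support) fun k hk => ?_).trans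
          (Finset.sum_congr rfl fun k _ => (map_smul _ _ _).symm)
        simp [Finsupp.notMem_support_iff.1 hk]
    obtain ⟨y, _, ψ, hψ, hlim⟩ := (hC.image_of_continuousOn hcont).tendsto_subseq hmem
    exact ⟨y, ψ, hψ, hlim⟩

/-- An operator with finite-dimensional kernel and closed range on an infinite-dimensional closed
subspace is not strictly singular there. -/
lemma not_isStrictlySingular_of_isClosed_map [CompleteSpace F] [CompleteSpace Y]
    {T : F →L[ℝ] Y} {G : Submodule ℝ F} (hG : IsClosed (G : Set F))
    (hGinf : ¬ FiniteDimensional ℝ G)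
    (hker : FiniteDimensional ℝ (G ⊓ LinearMap.ker T.toLinearMap : Submodule ℝ F))
    (hran : IsClosed ((G.map T.toLinearMap : Submodule ℝ Y) : Set Y)) :
    ¬ IsStrictlySingular (T.comp G.subtypeL) := by
  have : CompleteSpace G := hG.completeSpace_coe
  set S := T.comp G.subtypeL with hS
  set N := LinearMap.ker S.toLinearMap with hN
  have hNfin : FiniteDimensional ℝ N := by
    refine FiniteDimensional.of_injective
      ((G.subtype.comp N.subtype).codRestrict (G ⊓ LinearMap.ker T.toLinearMap) fun x =>
        ⟨x.1.2, x.2⟩) ?_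
    intro a b hab
    have hab' := congrArg Subtype.val hab
    exact Subtype.ext (Subtype.ext hab')
  obtain ⟨M, hMcl, hM⟩ :=
    (Submodule.ClosedComplemented.of_finiteDimensional (𝕜 := ℝ) N).exists_isClosed_isCompl
  have : CompleteSpace M := hMcl.completeSpace_coe
  have hinj : Function.Injective (S.comp M.subtypeL) := by
    refine (injective_iff_map_eq_zero _).2 ?_
    rintro ⟨x, hx⟩ h
    have hx0 : x ∈ (⊥ : Submodule ℝ G) := hM.inf_eq_bot ▸ ⟨h, hx⟩
    exact Subtype.ext ((Submodule.mem_bot ℝ).1 hx0)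
  have hrange : IsClosed (Set.range (S.comp M.subtypeL)) := by
    convert hran using 1
    ext y
    constructor
    · rintro ⟨x, rfl⟩
      exact ⟨x.1.1, x.1.2, rfl⟩
    · rintro ⟨x, hx, rfl⟩
      obtain ⟨n, hn, m, hm, hnm⟩ := Submodule.mem_sup.1
        (hM.sup_eq_top ▸ Submodule.mem_top : (⟨x, hx⟩ : G) ∈ N ⊔ M)
      refine ⟨⟨m, hm⟩, ?_⟩
      have hn' : S n = 0 := hn
      have : S (n + m) = S ⟨x, hx⟩ := by rw [hnm]
      rw [map_add, hn', zero_add] at this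
      exact this
  obtain ⟨c, hc⟩ := (S.comp M.subtypeL).antilipschitz_of_injective_of_isClosed_range hinj hrange
  -- `c + 1` rather than `c`, since the antilipschitz constant may be zero.
  refine not_not.2 ⟨M, fun hMfin => hGinf ?_, (c + 1 : ℝ)⁻¹, by positivity, fun x hx => ?_⟩
  · have : FiniteDimensional ℝ (⊤ : Submodule ℝ G) := by
      rw [← hM.sup_eq_top]; infer_instance
    exact Module.finite_def.2 (Module.Finite.iff_fg.1 this)
  · have h1 : ‖x‖ ≤ c * ‖S x‖ := by
      simpa using hc.le_mul_norm (map_zero _) (⟨x, hx⟩ : M)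
    rw [inv_mul_le_iff₀ (by positivity)]
    nlinarith [norm_nonneg (S x)]

end Operator

/-! ### The quotient map -/

section Quotient

variable {F : Type*} [NormedAddCommGroup F] [NormedSpace ℝ F] (H : Submodule ℝ F)

lemma ker_mkQL : LinearMap.ker H.mkQL.toLinearMap = H := H.ker_mkQ

/-- `G ⊔ H` is the full preimage of the image of `G` under a topological quotient map. -/
lemma isClosed_sup_iff (G : Submodule ℝ F) :
    IsClosed ((G ⊔ H : Submodule ℝ F) : Set F) ↔
      IsClosed ((G.map H.mkQL.toLinearMap : Submodule ℝ (F ⧸ H)) : Set (F ⧸ H)) := by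
  rw [← (Submodule.isQuotientMap_mkQL H).isClosed_preimage, sup_comm, ← Submodule.comap_map_mkQ]
  rfl

lemma exists_mem_norm_sub_lt (x : F) {ε : ℝ} (hε : 0 < ε) :
    ∃ h ∈ H, ‖x - h‖ < ‖H.mkQL x‖ + ε := by
  obtain ⟨m, hm, hlt⟩ := Submodule.Quotient.norm_mk_lt (H.mkQL x) hε
  refine ⟨x - m, (Submodule.Quotient.eq H).1 hm.symm, ?_⟩
  simpa using hlt

end Quotient

/-! ### The implications -/

variable {F : Type*} [NormedAddCommGroup F] [NormedSpace ℝ F] [Lattice F]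
    [IsOrderedAddMonoid F] [IsOrderedModule ℝ F] [HasSolidNorm F]

/-- A subspace on which the quotient map by a dispersed subspace is compact is dispersed. -/
lemma IsDispersed.of_compact_mkQL {H K : Submodule ℝ F} [IsClosed (H : Set F)]
    (hH : IsDispersed H)
    (hK : ∀ e : ℕ → F, (∀ n, e n ∈ K ∧ ‖e n‖ ≤ 1) →
      ∃ y, ∃ ψ : ℕ → ℕ, StrictMono ψ ∧ Tendsto (fun n => H.mkQL (e (ψ n))) atTop (𝓝 y)) :
    IsDispersed K := by
  rintro ⟨e, he, f, hf, hfe⟩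
  obtain ⟨y, ψ, hψ, hlim⟩ := hK e fun n => ⟨(he n).1, (he n).2.le⟩
  have heven : StrictMono fun n => ψ (2 * n) := fun m n h => hψ (by omega)
  have hodd : StrictMono fun n => ψ (2 * n + 1) := fun m n h => hψ (by omega)
  have h2 : Tendsto (fun n : ℕ => 2 * n) atTop atTop :=
    tendsto_atTop_mono (fun n => by simp only [id]; omega) tendsto_id
  have h3 : Tendsto (fun n : ℕ => 2 * n + 1) atTop atTop :=
    tendsto_atTop_mono (fun n => by simp only [id]; omega) tendsto_id
  set u : ℕ → F := fun n => e (ψ (2 * n)) - e (ψ (2 * n + 1)) with hu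
  set d : ℕ → F := fun n => f (ψ (2 * n)) - f (ψ (2 * n + 1)) with hd
  have hd_disj : IsDisjointSeq d := by
    intro m n hmn
    have hmem (k : ℕ) :
        d k ∈ Submodule.span ℝ (f '' {ψ (2 * k), ψ (2 * k + 1)}) :=
      Submodule.sub_mem _ (Submodule.subset_span ⟨_, by simp, rfl⟩)
        (Submodule.subset_span ⟨_, by simp, rfl⟩)
    refine hf.inf_eq_zero_of_mem_span ?_ (hmem m) (hmem n)
    simp [Set.disjoint_left, hψ.injective.eq_iff]
    omega
  have hQ : Tendsto (fun n => ‖H.mkQL (u n)‖) atTop (𝓝 0) := by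
    have := ((hlim.comp h2).sub (hlim.comp h3)).norm
    simpa [hu, Function.comp_def, map_sub] using this
  choose h hhH hh using fun n : ℕ =>
    exists_mem_norm_sub_lt H (u n) (ε := 1 / ((n : ℝ) + 1)) Nat.one_div_pos_of_nat
  have huh : Tendsto (fun n => ‖u n - h n‖) atTop (𝓝 0) := by
    refine squeeze_zero (fun _ => norm_nonneg _) (fun n => (hh n).le) ?_
    simpa using hQ.add tendsto_one_div_add_atTop_nhds_zero_nat
  have hdu : Tendsto (fun n => ‖d n - u n‖) atTop (𝓝 0) := by
    have h4 := tendsto_zero_iff_norm_tendsto_zero.2 hfe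
    have := ((h4.comp heven.tendsto_atTop).sub (h4.comp hodd.tendsto_atTop)).norm
    rw [sub_zero, norm_zero] at this
    refine this.congr fun n => ?_
    simp only [Function.comp_apply, hd, hu]
    congr 1
    abel
  have hdh : Tendsto (fun n => ‖d n - h n‖) atTop (𝓝 0) := by
    refine squeeze_zero (fun _ => norm_nonneg _) (fun n => ?_) (by simpa using hdu.add huh)
    exact norm_sub_le_norm_sub_add_norm_sub _ _ _
  refine not_isDispersed_of_tendsto hhH hd_disj (c := 1 / 2) (by norm_num) ?_ hdh hH
  have hsmall : ∀ᶠ n in atTop, ‖f (ψ (2 * n)) - e (ψ (2 * n))‖ + ‖d n - h n‖ < 1 / 2 := by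
    have := (hfe.comp heven.tendsto_atTop).add hdh
    rw [add_zero] at this
    exact this.eventually_lt_const (by norm_num)
  filter_upwards [hsmall] with n hn
  -- Disjointness prevents cancellation in `d n`, which keeps `h n` away from zero.
  have hfd : ‖f (ψ (2 * n))‖ ≤ ‖d n‖ := by
    refine norm_le_norm_of_abs_le_abs ?_
    rw [hd]
    simp only [sub_eq_add_neg]
    refine abs_le_abs_add_of_inf_eq_zero ?_
    rw [abs_neg]
    exact hf fun h => by have := hψ.injective h; omega
  have h5 := norm_sub_norm_le (e (ψ (2 * n))) (f (ψ (2 * n)))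
  have h6 := norm_sub_norm_le (d n) (h n)
  rw [(he _).2, norm_sub_rev] at h5
  linarith

lemma IsDispersed.finiteDimensional_inf_and_isClosed_sup [CompleteSpace F] {H : Submodule ℝ F}
    [IsClosed (H : Set F)] (hH : IsDispersed H) {G : Submodule ℝ F} (hGcl : IsClosed (G : Set F))
    (hG : IsAntiDispersed G) :
    FiniteDimensional ℝ (G ⊓ H : Submodule ℝ F) ∧
      IsClosed ((G ⊔ H : Submodule ℝ F) : Set F) := by
  by_contra hne
  rw [isClosed_sup_iff, ← congrArg (fun N => FiniteDimensional ℝ (G ⊓ N : Submodule ℝ F))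
    (ker_mkQL H)] at hne
  obtain ⟨K, hKG, hKinf, hK⟩ := exists_infinite_dimensional_compact_restriction hGcl hne
  exact hG ⟨K, hKG, hKinf, hH.of_compact_mkQL hK⟩

omit [HasSolidNorm F] in
/-- The closed span of a disjoint sequence is anti-dispersed. -/
lemma IsDisjointSeq.isAntiDispersed_closedSpan {f : ℕ → F} (hf : IsDisjointSeq f) :
    IsAntiDispersed (closedSpan f) := by
  rintro ⟨K, hKf, hKinf, hK⟩
  -- Gliding hump: a unit vector of `K` in the tail from `n` is nearly a finite block ending before
  -- `m`; iterating `m` makes successive blocks disjoint.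
  have key (n : ℕ) : ∃ x y m, n < m ∧ x ∈ K ∧ ‖x‖ = 1 ∧
      y ∈ Submodule.span ℝ (f '' Set.Ico n m) ∧ ‖y - x‖ ≤ 1 / ((n : ℝ) + 1) := by
    obtain ⟨x, hxK, hx1, hx⟩ := exists_norm_eq_one_mem_tail hKinf hKf n
    obtain ⟨y, hy, hxy⟩ := Metric.mem_closure_iff.1 hx (1 / ((n : ℝ) + 1)) Nat.one_div_pos_of_nat
    obtain ⟨a, ha, rfl⟩ := (Finsupp.mem_span_image_iff_linearCombination ℝ).1 hy
    obtain ⟨N, hN⟩ := a.support.exists_nat_subset_range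
    refine ⟨x, _, max N (n + 1), by omega, hxK, hx1,
      (Finsupp.mem_span_image_iff_linearCombination ℝ).2 ⟨a, fun j hj => ?_, rfl⟩, ?_⟩
    · have h1 : n ≤ j := ha hj
      have h2 := Finset.mem_range.1 (hN hj)
      exact ⟨h1, by omega⟩
    · rw [← dist_eq_norm, dist_comm]
      exact hxy.le
  choose x y m hm hxK hx1 hy hxy using key
  set s : ℕ → ℕ := fun k => m^[k] 0
  have hs_succ (k : ℕ) : s (k + 1) = m (s k) := Function.iterate_succ_apply' m k 0
  have hs : StrictMono s := strictMono_nat_of_lt_succ fun k => by rw [hs_succ]; exact hm _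
  refine hK ⟨fun k => x (s k), fun k => ⟨hxK _, hx1 _⟩, fun k => y (s k), ?_, ?_⟩
  · have hlt (j k : ℕ) (hjk : j < k) : |y (s j)| ⊓ |y (s k)| = 0 := by
      refine hf.inf_eq_zero_of_mem_span ?_ (hy (s j)) (hy (s k))
      have hle : m (s j) ≤ s k := hs_succ j ▸ hs.monotone hjk
      exact Set.disjoint_left.2 fun i hi hi' => by
        have := hi.2
        have := hi'.1
        omega
    intro j k hjk
    rcases hjk.lt_or_gt with h | h
    · exact hlt j k h
    · exact inf_comm _ _ |>.trans (hlt k j h)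
  · exact squeeze_zero (fun _ => norm_nonneg _) (fun k => hxy (s k))
      (tendsto_one_div_add_atTop_nhds_zero_nat.comp hs.tendsto_atTop)

lemma isDNS_mkQL_of_forall_disjoint [CompleteSpace F] {H : Submodule ℝ F} [IsClosed (H : Set F)]
    (h : ∀ f : ℕ → F, IsDisjointSeq f → FiniteDimensional ℝ (closedSpan f ⊓ H : Submodule ℝ F) ∧
      IsClosed ((closedSpan f ⊔ H : Submodule ℝ F) : Set F)) : IsDNS H.mkQL := by
  intro f hf h0
  obtain ⟨h1, h2⟩ := h f hf
  refine not_isStrictlySingular_of_isClosed_map (Submodule.isClosed_topologicalClosure _) ?_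
    (by rwa [ker_mkQL]) ((isClosed_sup_iff H _).1 h2)
  intro (hfin : FiniteDimensional ℝ (Submodule.span ℝ (Set.range f)).topologicalClosure)
  exact not_finiteDimensional_span (hf.linearIndependent h0)
    (Submodule.finiteDimensional_of_le (Submodule.le_topologicalClosure _))

/-- An operator that tends to zero fast along a disjoint sequence bounded away from zero is
strictly singular on the closed span of that sequence. -/
lemma IsDisjointSeq.isStrictlySingular {Y : Type*} [NormedAddCommGroup Y] [NormedSpace ℝ Y]
    {f : ℕ → F} (hf : IsDisjointSeq f) (hlow : ∀ n, 1 / 2 ≤ ‖f n‖) {T : F →L[ℝ] Y}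
    (hT : ∀ n, ‖T (f n)‖ ≤ (1 / 2) ^ n) :
    IsStrictlySingular (T.comp (closedSpan f).subtypeL) := by
  rintro ⟨M, hM, c, hc, hbound⟩
  have hfin (n : ℕ) (v : F) (hv : v ∈ Submodule.span ℝ (f '' Set.Ici n)) :
      ‖T v‖ ≤ 4 * (1 / 2) ^ n * ‖v‖ := by
    obtain ⟨a, ha, rfl⟩ := (Finsupp.mem_span_image_iff_linearCombination ℝ).1 hv
    set v := Finsupp.linearCombination ℝ f a with hv
    have hcoef (k : ℕ) : |a k| ≤ 2 * ‖v‖ := by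
      have := hf.norm_smul_le_norm_linearCombination a k
      rw [norm_smul, Real.norm_eq_abs] at this
      nlinarith [hlow k, abs_nonneg (a k)]
    obtain ⟨N, hN⟩ := a.support.exists_nat_subset_range
    have hsub : a.support ⊆ Finset.Ico n N := fun j hj =>
      Finset.mem_Ico.2 ⟨ha hj, Finset.mem_range.1 (hN hj)⟩
    calc ‖T v‖ = ‖∑ j ∈ Finset.Ico n N, a j • T (f j)‖ := by
          rw [hv, Finsupp.linearCombination_apply, Finsupp.sum_of_support_subset a hsub _ (by simp),
            map_sum]
          simp only [map_smul]
      _ ≤ ∑ j ∈ Finset.Ico n N, 2 * ‖v‖ * (1 / 2) ^ j := by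
          refine norm_sum_le_of_le _ fun j _ => ?_
          rw [norm_smul, Real.norm_eq_abs]
          exact mul_le_mul (hcoef j) (hT j) (norm_nonneg _) (by positivity)
      _ = 2 * ‖v‖ * ∑ j ∈ Finset.Ico n N, (1 / 2) ^ j := by rw [Finset.mul_sum]
      _ ≤ 2 * ‖v‖ * ((1 / 2) ^ n / (1 - 1 / 2)) := by
          gcongr
          exact geom_sum_Ico_le_of_lt_one (by norm_num) (by norm_num)
      _ = 4 * (1 / 2) ^ n * ‖v‖ := by ring
  have hclosure (n : ℕ) (v : F)
      (hv : v ∈ (Submodule.span ℝ (f '' Set.Ici n)).topologicalClosure) :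
      ‖T v‖ ≤ 4 * (1 / 2) ^ n * ‖v‖ := by
    refine closure_minimal (t := {v | ‖T v‖ ≤ 4 * (1 / 2) ^ n * ‖v‖}) (fun v hv => hfin n v hv)
      (isClosed_le (by fun_prop) (by fun_prop)) hv
  -- On this tail `T` has norm below `c`, yet `M` contains a unit vector of it.
  obtain ⟨n, hn⟩ := exists_pow_lt_of_lt_one (show 0 < c / 4 by positivity)
    (show (1 / 2 : ℝ) < 1 by norm_num)
  have hM' : ¬ FiniteDimensional ℝ (M.map (closedSpan f).subtype) := fun h =>
    hM (Module.Finite.equiv (M.equivMapOfInjective _ (closedSpan f).injective_subtype).symm)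
  obtain ⟨x, hxM, hx1, hx⟩ := exists_norm_eq_one_mem_tail hM' (Submodule.map_subtype_le _ _) n
  obtain ⟨z, hz, rfl⟩ := hxM
  have h1 := hbound z hz
  have h2 := hclosure n _ hx
  have h3 : ‖z‖ = 1 := hx1
  rw [hx1] at h2
  rw [h3] at h1
  have h4 : c * 1 ≤ 4 * (1 / 2) ^ n * 1 := h1.trans h2
  linarith

lemma isDispersed_of_isDNS_mkQL {H : Submodule ℝ F} [IsClosed (H : Set F)]
    (h : IsDNS H.mkQL) : IsDispersed H := by
  rintro ⟨e, he, f, hf, hfe⟩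
  -- The exponent `n + 1` gives `‖f (φ n)‖ ≥ 1 / 2` already at `n = 0`.
  obtain ⟨φ, hφ, hφlt⟩ := extraction_forall_of_eventually'
    (P := fun n k => ‖f k - e k‖ < (1 / 2) ^ (n + 1)) fun n => by
      obtain ⟨N, hN⟩ := eventually_atTop.1 (hfe.eventually_lt_const (u := (1 / 2) ^ (n + 1))
        (by positivity))
      exact ⟨N, hN⟩
  have hpow (n : ℕ) : (1 / 2 : ℝ) ^ (n + 1) ≤ 1 / 2 :=
    pow_le_of_le_one (by norm_num) (by norm_num) (by omega)
  have hlow (n : ℕ) : 1 / 2 ≤ ‖(f ∘ φ) n‖ := by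
    have h1 := norm_sub_norm_le (e (φ n)) (f (φ n))
    rw [(he _).2, norm_sub_rev] at h1
    have := hφlt n
    have := hpow n
    simp only [Function.comp_apply]
    linarith
  have hdisj := hf.comp hφ.injective
  refine h (f ∘ φ) hdisj (fun n h0 => ?_) (hdisj.isStrictlySingular hlow fun n => ?_)
  · have := hlow n
    rw [h0, norm_zero] at this
    linarith
  · have h0 : H.mkQL (e (φ n)) = 0 := (Submodule.Quotient.mk_eq_zero H).2 (he _).1
    have h1 : H.mkQL (f (φ n)) = H.mkQL (f (φ n) - e (φ n)) := by rw [map_sub, h0, sub_zero]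
    simp only [Function.comp_apply]
    rw [h1]
    exact (Submodule.Quotient.norm_mk_le (S := H) _).trans ((hφlt n).le.trans
      (pow_le_pow_of_le_one (by norm_num) (by norm_num) (by omega)))

end BanachLattice

theorem mainTheorem9 {F : Type*} [NormedAddCommGroup F] [NormedSpace ℝ F] [Lattice F]
    [IsOrderedAddMonoid F] [IsOrderedModule ℝ F] [HasSolidNorm F] [CompleteSpace F]
    (H : Submodule ℝ F) [hH : IsClosed (H : Set F)] :
    List.TFAE [
      BanachLattice.IsDispersed H,
      BanachLattice.IsDNS H.mkQL,
      ∀ G : Submodule ℝ F, IsClosed (G : Set F) → BanachLattice.IsAntiDispersed G →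
        FiniteDimensional ℝ (G ⊓ H : Submodule ℝ F) ∧
          IsClosed ((G ⊔ H : Submodule ℝ F) : Set F),
      ∀ f : ℕ → F, BanachLattice.IsDisjointSeq f →
        FiniteDimensional ℝ (BanachLattice.closedSpan f ⊓ H : Submodule ℝ F) ∧
          IsClosed ((BanachLattice.closedSpan f ⊔ H : Submodule ℝ F) : Set F)] := by
  tfae_have 1 → 3 := fun h _ hGcl hG => h.finiteDimensional_inf_and_isClosed_sup hGcl hG
  tfae_have 3 → 4 := fun h f hf =>
    h _ (Submodule.isClosed_topologicalClosure _) hf.isAntiDispersed_closedSpan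
  tfae_have 4 → 2 := BanachLattice.isDNS_mkQL_of_forall_disjoint
  tfae_have 2 → 1 := BanachLattice.isDispersed_of_isDNS_mkQL
  tfae_finish
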